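/- Let $a>-1$ and $b>-1$ be real numbers, at least one of them positive, set $D=2+a+b$, and write $(\mathbb R_+)^2=\{(\sigma,\tau)\in\mathbb R^2:\sigma>0,\ \tau>0\}$. Then for each real $q$ with $1\le q<D$ there exists a constant $C>0$, depending only on $a$, $b$ and $q$, such that the following holds. Let $u:\mathbb R^2\to\mathbb R$ be a nonnegative Lipschitz function with compact support in $\mathbb R^2$ which is of class $C^1$ on the open set $\{u>0\}$ and satisfies $$u_\sigma\le 0\quad\text{and}\quad u_\tau\le 0\qquad\text{in }(\mathbb R_+)^2$$ (wherever these partial derivatives exist), with both inequalities strict at every point of $(\mathbb R_+)^2$ where $u>0$. Then $$\left(\int_{(\mathbb R_+)^2}\sigma^a\tau^b|u|^{q^*}\,d\sigma\,d\tau\right)^{1/q^*}\le C\left(\int_{(\mathbb R_+)^2}\sigma^a\tau^b|\nabla u|^{q}\,d\sigma\,d\tau\right)^{1/q},\qquad q^*=\frac{Dq}{D-q},$$ where both integrals are finite. -/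

import Mathlib

open Set MeasureTheory
open scoped NNReal

noncomputable section

/-- The open quadrant `(ℝ_+)² = {(σ, τ) : σ > 0, τ > 0}` of the plane. -/
def quadrant : Set (ℝ × ℝ) := Ioi 0 ×ˢ Ioi 0

/-- The partial derivative `u_σ` at the point `p = (σ, τ)`. -/
def partialSigma (u : ℝ × ℝ → ℝ) (p : ℝ × ℝ) : ℝ := deriv (fun s => u (s, p.2)) p.1

/-- The partial derivative `u_τ` at the point `p = (σ, τ)`. -/
def partialTau (u : ℝ × ℝ → ℝ) (p : ℝ × ℝ) : ℝ := deriv (fun t => u (p.1, t)) p.2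

/-- The Euclidean length `|∇u|` of the gradient. (For a Lipschitz `u` both partial derivatives
exist at almost every point.) -/
def gradNorm (u : ℝ × ℝ → ℝ) (p : ℝ × ℝ) : ℝ :=
  Real.sqrt (partialSigma u p ^ 2 + partialTau u p ^ 2)

/-- The monomial weight `σ^a τ^b`; it is only used on the open quadrant. -/
def monomialWeight (a b : ℝ) (p : ℝ × ℝ) : ℝ := p.1 ^ a * p.2 ^ b

/-- The functions to which the inequality applies: nonnegative Lipschitz functions with compact
support in the plane, of class `C¹` on the (open) set `{u > 0}`, with `u_σ ≤ 0` and `u_τ ≤ 0` in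
the open quadrant, strictly wherever `u > 0` there. The metric of `ℝ × ℝ` is the sup metric, which
gives the same Lipschitz functions as the Euclidean one. -/
structure IsAdmissible (u : ℝ × ℝ → ℝ) : Prop where
  nonneg : ∀ p, 0 ≤ u p
  lipschitz : ∃ K : ℝ≥0, LipschitzWith K u
  compact_support : HasCompactSupport u
  contDiffOn : ContDiffOn ℝ 1 u {p | 0 < u p}
  partialSigma_nonpos : ∀ p ∈ quadrant, partialSigma u p ≤ 0
  partialTau_nonpos : ∀ p ∈ quadrant, partialTau u p ≤ 0
  partialSigma_neg : ∀ p ∈ quadrant, 0 < u p → partialSigma u p < 0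
  partialTau_neg : ∀ p ∈ quadrant, 0 < u p → partialTau u p < 0

end

open scoped ENNReal

/-!
The inequality is a weighted isoperimetric inequality for sets that are decreasing in both
coordinates, integrated over the superlevel sets of `u`.

Write `dμ = σ ^ a τ ^ b dσ dτ`, `V t = μ {u > t}` and `r t = V t ^ (1 / D)`, and suppose `b > 0`
(the case `a > 0` follows by exchanging the coordinates). Since `u` strictly decreases in each
variable where it is positive, `{u > t}` contains the rectangle below each of its boundary points
`(σ, τ)`, so `σ ^ (a + 1) τ ^ (b + 1)` is at most a constant times `r ^ D`. Hence `σ ≤ c r` as soon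
as `τ ≥ r` (`le_levelRadius`), and a horizontal line at height `τ ≥ r` meets the superlevel set in
an interval `(0, σ)` with `∫ x ^ a dx ≤ c r σ ^ a`. On a vertical line the part below height `r` has
`∫ y ^ b dy ≤ c r τ ^ b`, because `b ≥ 0`.

No coarea formula is needed. Along a line, `t = u` is a change of variables
(`lintegral_superlevel_le`), so `∫ σ ^ a g(u) |u_σ| dσ` is the integral over the levels `t` of
`g(t) σ ^ a` at the end point `σ` of the superlevel interval. Bounding horizontal lines at heights
`τ ≥ r t` and vertical lines truncated to `τ < r t`, and adding, gives
`∫ g(t) V t ^ (1 - 1 / D) dt ≤ c ∫ g(u) |∇u| dμ` (`lintegral_levelMeasure_rpow_le`).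

With `p = D / (D - 1)` and `g(t) = t ^ (γ - 1)`, `γ = q* / p`, the left side controls
`(∫ u ^ q* dμ) ^ (1 / p)` by the layer cake formula
(`lintegral_rpow_le_lintegral_measure_rpow`), and Hölder's inequality on the right side
(`lintegral_rpow_mul_gradNorm_le`) leaves a power of `∫ u ^ q* dμ`, which is finite and can be
cancelled.
-/

/-! ### Decreasing functions of one variable -/

/-- A continuous function that strictly decreases wherever it is positive cannot become positive
again after vanishing, so it strictly decreases up to any point at which it is positive. -/
theorem lt_of_deriv_neg_of_pos {f : ℝ → ℝ} (hc : Continuous f)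
    (hd : ∀ x, 0 < x → 0 < f x → deriv f x < 0) {x y : ℝ} (hx : 0 < x) (hxy : x < y)
    (hy : 0 < f y) : f y < f x := by
  have anti : ∀ z, 0 < z → z < y → (∀ w ∈ Ioo z y, 0 < f w) → f y < f z := by
    intro z hz hzy hw
    have h : StrictAntiOn f (Icc z y) := by
      refine strictAntiOn_of_deriv_neg (convex_Icc z y) hc.continuousOn fun w hw' => ?_
      rw [interior_Icc] at hw'
      exact hd w (hz.trans hw'.1) (hw w hw')
    exact h (left_mem_Icc.2 hzy.le) (right_mem_Icc.2 hzy.le) hzy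
  -- A last zero of `f` before `y` would be followed by a stretch on which `f` decreases.
  have hpos : ∀ w ∈ Icc x y, 0 < f w := by
    by_contra! hcon
    obtain ⟨w, hw, hw0⟩ := hcon
    have hK : IsCompact (Icc x y ∩ {z | f z ≤ 0}) :=
      isCompact_Icc.inter_right (isClosed_le hc continuous_const)
    obtain ⟨z, ⟨hz, hz0⟩, hmax⟩ := hK.exists_isGreatest ⟨w, hw, hw0⟩
    have hzy : z < y := by
      refine lt_of_le_of_ne hz.2 ?_
      rintro rfl
      exact absurd hy (not_lt.2 hz0)
    have := anti z (hx.trans_le hz.1) hzy fun v hv => by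
      by_contra hv0
      exact absurd (hmax ⟨⟨hz.1.trans hv.1.le, hv.2.le⟩, not_lt.1 hv0⟩) (not_le.2 hv.1)
    exact absurd (hy.trans this) (not_lt.2 hz0)
  exact anti x hx hxy fun w hw => hpos w ⟨hw.1.le, hw.2.le⟩

/-- One-dimensional coarea inequality: the level sets `{f > t}` on the half-line are the intervals
`(0, ψ t)`, where `ψ` is the inverse of `f`, and `t = f x` is a change of variables. The set
function `N t` need not be a measure. -/
theorem lintegral_superlevel_le {f : ℝ → ℝ} (hc : Continuous f)
    (hd : ∀ x, 0 < x → 0 < f x → deriv f x < 0) (hz : ∀ x, ∃ y, x < y ∧ f y = 0)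
    {N : ℝ → Set ℝ → ℝ≥0∞} (hN : ∀ t, N t ∅ = 0) {h : ℝ → ℝ≥0∞}
    (hh : ∀ x, 0 < x → 0 < f x → N (f x) (Ioo 0 x) ≤ h x) :
    ∫⁻ t in Ioi 0, N t {x | 0 < x ∧ t < f x} ≤
      ∫⁻ x in Ioi 0, ENNReal.ofReal |deriv f x| * h x := by
  set s : Set ℝ := {x | 0 < x ∧ 0 < f x} with hs
  have hsm : MeasurableSet s :=
    measurableSet_Ioi.inter (measurableSet_lt measurable_const hc.measurable)
  have hlt : ∀ {x y}, 0 < x → x < y → 0 < f y → f y < f x :=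
    fun hx hxy hy => lt_of_deriv_neg_of_pos hc hd hx hxy hy
  have hinj : InjOn f s := by
    intro x hx y hy hxy
    rcases lt_trichotomy x y with h | h | h
    · exact absurd hxy (hlt hx.1 h hy.2).ne'
    · exact h
    · exact absurd hxy (hlt hy.1 h hx.2).ne
  have hder : ∀ x ∈ s, HasDerivWithinAt f (deriv f x) s x := fun x hx =>
    (differentiableAt_of_deriv_ne_zero (hd x hx.1 hx.2).ne).hasDerivAt.hasDerivWithinAt
  have hlev : ∀ x ∈ s, {y | 0 < y ∧ f x < f y} = Ioo 0 x := by
    intro x hx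
    ext y
    constructor
    · rintro ⟨hy, hxy⟩
      refine ⟨hy, ?_⟩
      by_contra hcon
      rcases (not_lt.1 hcon).eq_or_lt with h | h
      · exact hxy.ne (by rw [h])
      · exact absurd (hlt hx.1 h (hx.2.trans hxy)) (not_lt.2 hxy.le)
    · rintro ⟨hy, hyx⟩
      exact ⟨hy, hlt hy hyx hx.2⟩
  have hsub : f '' s ⊆ Ioi 0 := by
    rintro _ ⟨x, hx, rfl⟩
    exact hx.2
  have hempty : ∀ t ∈ Ioi (0 : ℝ), t ∉ f '' s → N t {x | 0 < x ∧ t < f x} = 0 := by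
    intro t ht hts
    have : {x | 0 < x ∧ t < f x} = ∅ := by
      refine eq_empty_of_forall_notMem ?_
      rintro x ⟨hx, hxt⟩
      obtain ⟨y, hxy, hy⟩ := hz x
      have ht' : (0 : ℝ) < t := ht
      obtain ⟨w, hw, hwt⟩ := intermediate_value_Icc' hxy.le hc.continuousOn
        (show t ∈ Icc (f y) (f x) from ⟨by rw [hy]; exact ht'.le, hxt.le⟩)
      exact hts ⟨w, ⟨hx.trans_le hw.1, by rw [hwt]; exact ht'⟩, hwt⟩
    rw [this, hN]
  have hmi : MeasurableSet (f '' s) :=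
    hsm.image_of_continuousOn_injOn hc.continuousOn hinj
  calc ∫⁻ t in Ioi 0, N t {x | 0 < x ∧ t < f x}
      ≤ ∫⁻ t in f '' s, N t {x | 0 < x ∧ t < f x} := by
        rw [← lintegral_indicator hmi, ← lintegral_indicator measurableSet_Ioi]
        refine lintegral_mono fun t => ?_
        by_cases ht : t ∈ f '' s
        · simp only [indicator_of_mem ht, indicator_of_mem (hsub ht)]
          exact le_rfl
        · by_cases ht0 : t ∈ Ioi (0 : ℝ)
          · simp only [indicator_of_mem ht0, hempty t ht0 ht]
            exact zero_le
          · simp [indicator_of_notMem ht0]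
    _ = ∫⁻ x in s, ENNReal.ofReal |deriv f x| * N (f x) {y | 0 < y ∧ f x < f y} :=
        lintegral_image_eq_lintegral_abs_deriv_mul hsm hder hinj _
    _ ≤ ∫⁻ x in s, ENNReal.ofReal |deriv f x| * h x := by
        refine setLIntegral_mono' hsm fun x hx => ?_
        rw [hlev x hx]
        gcongr
        exact hh x hx.1 hx.2
    _ ≤ ∫⁻ x in Ioi 0, ENNReal.ofReal |deriv f x| * h x :=
        lintegral_mono_set fun x hx => hx.1

/-! ### The weighted measures -/

/-- The measure `x ^ a dx` on the half-line `(0, ∞)`, as a measure on `ℝ`. -/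
noncomputable def powMeasure (a : ℝ) : Measure ℝ :=
  (volume.restrict (Ioi 0)).withDensity fun x => ENNReal.ofReal (x ^ a)

instance (a : ℝ) : SFinite (powMeasure a) := by
  unfold powMeasure; infer_instance

/-- The measure `σ ^ a τ ^ b dσ dτ` on the quadrant, as a product measure on the plane. -/
noncomputable def monomialMeasure (a b : ℝ) : Measure (ℝ × ℝ) :=
  (powMeasure a).prod (powMeasure b)

instance (a b : ℝ) : SFinite (monomialMeasure a b) := by
  unfold monomialMeasure; infer_instance

theorem measurable_ofReal_rpow (a : ℝ) : Measurable fun x : ℝ => ENNReal.ofReal (x ^ a) :=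
  (measurable_id.pow_const a).ennreal_ofReal

theorem lintegral_powMeasure (a : ℝ) {g : ℝ → ℝ≥0∞} (hg : Measurable g) :
    ∫⁻ x, g x ∂powMeasure a = ∫⁻ x in Ioi 0, ENNReal.ofReal (x ^ a) * g x := by
  rw [powMeasure, lintegral_withDensity_eq_lintegral_mul _ (measurable_ofReal_rpow a) hg]
  rfl

theorem ae_powMeasure_pos (a : ℝ) : ∀ᵐ x ∂powMeasure a, 0 < x :=
  (withDensity_absolutelyContinuous _ _).ae_le (ae_restrict_mem measurableSet_Ioi)

theorem powMeasure_Ioo {a : ℝ} (ha : -1 < a) {x : ℝ} (hx : 0 ≤ x) :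
    powMeasure a (Ioo 0 x) = ENNReal.ofReal (x ^ (a + 1) / (a + 1)) := by
  have h0 : Ioo 0 x ∩ Ioi 0 = Ioo 0 x := inter_eq_left.2 fun y hy => hy.1
  rw [powMeasure, withDensity_apply _ measurableSet_Ioo,
    Measure.restrict_restrict measurableSet_Ioo, h0, restrict_Ioo_eq_restrict_Ioc, ← ofReal_integral_eq_lintegral_ofReal]
  · rw [← intervalIntegral.integral_of_le hx, integral_rpow (Or.inl ha),
      Real.zero_rpow (by linarith), sub_zero]
  · exact (intervalIntegrable_iff_integrableOn_Ioc_of_le hx).1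
      (intervalIntegral.intervalIntegrable_rpow' ha)
  · filter_upwards [ae_restrict_mem measurableSet_Ioc] with y hy
    exact Real.rpow_nonneg hy.1.le _

theorem powMeasure_setOf_pos (a : ℝ) (s : Set ℝ) :
    powMeasure a {x | 0 < x ∧ x ∈ s} = powMeasure a s :=
  measure_congr (by
    filter_upwards [ae_powMeasure_pos a] with x hx
    exact propext ⟨fun h => h.2, fun h => ⟨hx, h⟩⟩)

theorem monomialMeasure_eq_withDensity (a b : ℝ) :
    monomialMeasure a b =
      (volume.restrict quadrant).withDensity fun p => ENNReal.ofReal (monomialWeight a b p) := by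
  rw [monomialMeasure, powMeasure, powMeasure, prod_withDensity (measurable_ofReal_rpow a)
    (measurable_ofReal_rpow b), Measure.prod_restrict, ← Measure.volume_eq_prod]
  refine withDensity_congr_ae ?_
  filter_upwards [ae_restrict_mem (measurableSet_Ioi.prod measurableSet_Ioi)] with p hp
  rw [monomialWeight, ENNReal.ofReal_mul (Real.rpow_nonneg (le_of_lt hp.1) _)]

theorem measurable_monomialWeight (a b : ℝ) : Measurable (monomialWeight a b) :=
  (measurable_fst.pow_const a).mul (measurable_snd.pow_const b)

theorem monomialMeasure_lt_top_of_isCompact {a b : ℝ} (ha : -1 < a) (hb : -1 < b)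
    {k : Set (ℝ × ℝ)} (hk : IsCompact k) : monomialMeasure a b k < ∞ := by
  obtain ⟨R, hR⟩ := hk.isBounded.subset_closedBall 0
  have hlt : ∀ {c : ℝ}, -1 < c → powMeasure c (Iio (|R| + 1)) < ∞ := by
    intro c hc
    rw [← powMeasure_setOf_pos]
    exact (powMeasure_Ioo hc (by positivity)).trans_lt ENNReal.ofReal_lt_top
  have hsub : k ⊆ Iio (|R| + 1) ×ˢ Iio (|R| + 1) := by
    intro p hp
    have h := hR hp
    rw [mem_closedBall_zero_iff, Prod.norm_def, max_le_iff] at h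
    simp only [Real.norm_eq_abs] at h
    have hR1 := le_abs_self R
    exact ⟨mem_Iio.2 (by linarith [le_abs_self p.1, h.1]),
      mem_Iio.2 (by linarith [le_abs_self p.2, h.2])⟩
  refine (measure_mono hsub).trans_lt ?_
  rw [monomialMeasure, Measure.prod_prod]
  exact ENNReal.mul_lt_top (hlt ha) (hlt hb)

theorem lintegral_mul_prod_slice {μ ν ρ : Measure ℝ} [SFinite μ] [SFinite ν] [SFinite ρ]
    {M : ℝ → ℝ≥0∞} (hM : Measurable M) {S : Set (ℝ × ℝ × ℝ)} (hS : MeasurableSet S) :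
    ∫⁻ t, M t * μ.prod ν {p | (t, p) ∈ S} ∂ρ =
      ∫⁻ x, ∫⁻ t, M t * ν {y | (t, x, y) ∈ S} ∂ρ ∂μ := by
  have hS' : MeasurableSet {q : (ℝ × ℝ) × ℝ | (q.1.1, q.1.2, q.2) ∈ S} :=
    (show Measurable fun q : (ℝ × ℝ) × ℝ => (q.1.1, q.1.2, q.2) by fun_prop) hS
  have hm : Measurable fun q : ℝ × ℝ => ν {y | (q.1, q.2, y) ∈ S} :=
    measurable_measure_prodMk_left hS'
  rw [← lintegral_lintegral_swap
    (f := fun t x => M t * ν {y | (t, x, y) ∈ S}) ((hM.comp measurable_fst).mul hm).aemeasurable]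
  refine lintegral_congr fun t => ?_
  exact (congrArg (M t * ·) (Measure.prod_apply (measurable_prodMk_left hS))).trans
    (lintegral_const_mul _ (hm.comp measurable_prodMk_left)).symm

theorem lintegral_mul_prod_slice_symm {μ ν ρ : Measure ℝ} [SFinite μ] [SFinite ν] [SFinite ρ]
    {M : ℝ → ℝ≥0∞} (hM : Measurable M) {S : Set (ℝ × ℝ × ℝ)} (hS : MeasurableSet S) :
    ∫⁻ t, M t * μ.prod ν {p | (t, p) ∈ S} ∂ρ =
      ∫⁻ y, ∫⁻ t, M t * μ {x | (t, x, y) ∈ S} ∂ρ ∂ν := by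
  have hS' : MeasurableSet {q : ℝ × ℝ × ℝ | (q.1, q.2.2, q.2.1) ∈ S} :=
    (show Measurable fun q : ℝ × ℝ × ℝ => (q.1, q.2.2, q.2.1) by fun_prop) hS
  refine (lintegral_congr fun t => ?_).trans (lintegral_mul_prod_slice hM hS')
  refine congrArg (M t * ·) ?_
  rw [← Measure.prod_swap]
  exact Measure.map_apply measurable_swap (measurable_prodMk_left hS)

/-! ### Superlevel sets of an admissible function -/

namespace IsAdmissible

variable {u : ℝ × ℝ → ℝ}

theorem continuous (hu : IsAdmissible u) : Continuous u :=
  let ⟨_, hK⟩ := hu.lipschitz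
  hK.continuous

theorem continuous_sigma (hu : IsAdmissible u) (τ : ℝ) : Continuous fun s => u (s, τ) :=
  hu.continuous.comp (by fun_prop)

theorem continuous_tau (hu : IsAdmissible u) (σ : ℝ) : Continuous fun t => u (σ, t) :=
  hu.continuous.comp (by fun_prop)

theorem exists_bound (hu : IsAdmissible u) : ∃ R : ℝ, ∀ p : ℝ × ℝ, R < ‖p‖ → u p = 0 := by
  obtain ⟨R, hR⟩ := hu.compact_support.isCompact.isBounded.subset_closedBall 0
  refine ⟨R, fun p hp => image_eq_zero_of_notMem_tsupport fun h => ?_⟩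
  exact absurd (mem_closedBall_zero_iff.1 (hR h)) (not_le.2 hp)

theorem exists_zero_sigma (hu : IsAdmissible u) (τ x : ℝ) : ∃ y, x < y ∧ u (y, τ) = 0 := by
  obtain ⟨R, hR⟩ := hu.exists_bound
  refine ⟨max x R + 1, by linarith [le_max_left x R], hR _ ?_⟩
  calc R < max x R + 1 := by linarith [le_max_right x R]
    _ ≤ ‖max x R + 1‖ := Real.le_norm_self _
    _ ≤ _ := norm_fst_le (max x R + 1, τ)

theorem exists_zero_tau (hu : IsAdmissible u) (σ x : ℝ) : ∃ y, x < y ∧ u (σ, y) = 0 := by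
  obtain ⟨R, hR⟩ := hu.exists_bound
  refine ⟨max x R + 1, by linarith [le_max_left x R], hR _ ?_⟩
  calc R < max x R + 1 := by linarith [le_max_right x R]
    _ ≤ ‖max x R + 1‖ := Real.le_norm_self _
    _ ≤ _ := norm_snd_le (σ, max x R + 1)

theorem deriv_sigma_neg (hu : IsAdmissible u) {τ : ℝ} (hτ : 0 < τ) (x : ℝ) (hx : 0 < x)
    (h : 0 < u (x, τ)) : deriv (fun s => u (s, τ)) x < 0 :=
  hu.partialSigma_neg (x, τ) ⟨hx, hτ⟩ h

theorem deriv_tau_neg (hu : IsAdmissible u) {σ : ℝ} (hσ : 0 < σ) (x : ℝ) (hx : 0 < x)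
    (h : 0 < u (σ, x)) : deriv (fun t => u (σ, t)) x < 0 :=
  hu.partialTau_neg (σ, x) ⟨hσ, hx⟩ h

theorem Ioo_prod_Ioo_subset (hu : IsAdmissible u) {σ τ : ℝ} (hτ : 0 < τ)
    (h : 0 < u (σ, τ)) : Ioo 0 σ ×ˢ Ioo 0 τ ⊆ {p | u (σ, τ) < u p} := by
  rintro ⟨x, y⟩ ⟨hx, hy⟩
  have h1 : u (σ, τ) < u (x, τ) :=
    lt_of_deriv_neg_of_pos (hu.continuous_sigma τ) (hu.deriv_sigma_neg hτ) hx.1 hx.2 h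
  exact h1.trans (lt_of_deriv_neg_of_pos (hu.continuous_tau x) (hu.deriv_tau_neg hx.1) hy.1 hy.2
    (h.trans h1))

end IsAdmissible

/-- The weighted measure of the superlevel set `{u > t}` in the quadrant. -/
noncomputable def levelMeasure (a b : ℝ) (u : ℝ × ℝ → ℝ) (t : ℝ) : ℝ≥0∞ :=
  monomialMeasure a b {p | t < u p}

/-- The length scale `r` with `r ^ D` equal to the weighted measure of `{u > t}`, where
`D = 2 + a + b` is the homogeneous dimension. -/
noncomputable def levelRadius (a b : ℝ) (u : ℝ × ℝ → ℝ) (t : ℝ) : ℝ :=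
  (levelMeasure a b u t).toReal ^ (1 / (2 + a + b))

theorem levelMeasure_antitone (a b : ℝ) (u : ℝ × ℝ → ℝ) : Antitone (levelMeasure a b u) :=
  fun _ _ h => measure_mono fun _ hp => lt_of_le_of_lt h hp

theorem measurable_levelRadius (a b : ℝ) (u : ℝ × ℝ → ℝ) : Measurable (levelRadius a b u) :=
  (levelMeasure_antitone a b u).measurable.ennreal_toReal.pow_const _

section
variable {a b : ℝ} {u : ℝ × ℝ → ℝ}

theorem levelMeasure_ne_top (ha : -1 < a) (hb : -1 < b) (hu : IsAdmissible u) {t : ℝ}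
    (ht : 0 < t) : levelMeasure a b u t ≠ ∞ := by
  refine ((measure_mono fun p hp => ?_).trans_lt
    (monomialMeasure_lt_top_of_isCompact ha hb hu.compact_support.isCompact)).ne
  exact subset_tsupport _ (ht.trans hp).ne'

/-- The rectangle with corner `(σ, τ)` lies in the superlevel set at height `u (σ, τ)`. -/
theorem rpow_mul_rpow_le (ha : -1 < a) (hb : -1 < b) (hu : IsAdmissible u) {σ τ : ℝ}
    (hσ : 0 < σ) (hτ : 0 < τ) (h : 0 < u (σ, τ)) :
    σ ^ (a + 1) * τ ^ (b + 1) ≤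
      (a + 1) * (b + 1) * levelRadius a b u (u (σ, τ)) ^ (2 + a + b) := by
  have ha' : 0 < a + 1 := by linarith
  have hb' : 0 < b + 1 := by linarith
  have h1 : ENNReal.ofReal (σ ^ (a + 1) / (a + 1) * (τ ^ (b + 1) / (b + 1))) ≤
      levelMeasure a b u (u (σ, τ)) := by
    rw [ENNReal.ofReal_mul (by positivity), ← powMeasure_Ioo ha hσ.le, ← powMeasure_Ioo hb hτ.le,
      ← Measure.prod_prod]
    exact measure_mono (hu.Ioo_prod_Ioo_subset hτ h)
  rw [ENNReal.ofReal_le_iff_le_toReal (levelMeasure_ne_top ha hb hu h)] at h1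
  rw [levelRadius, ← Real.rpow_mul ENNReal.toReal_nonneg, one_div,
    inv_mul_cancel₀ (by linarith), Real.rpow_one]
  rw [div_mul_div_comm, div_le_iff₀ (by positivity)] at h1
  linarith

theorem levelRadius_pos (ha : -1 < a) (hb : -1 < b) (hu : IsAdmissible u) {σ τ : ℝ}
    (hσ : 0 < σ) (hτ : 0 < τ) (h : 0 < u (σ, τ)) : 0 < levelRadius a b u (u (σ, τ)) := by
  have h0 : 0 ≤ levelRadius a b u (u (σ, τ)) := Real.rpow_nonneg ENNReal.toReal_nonneg _
  refine h0.lt_of_ne' fun h1 => ?_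
  have h2 := rpow_mul_rpow_le ha hb hu hσ hτ h
  rw [h1, Real.zero_rpow (by linarith), mul_zero] at h2
  have : 0 < σ ^ (a + 1) * τ ^ (b + 1) := by positivity
  linarith

/-- At heights above the scale `r`, the superlevel set is at most comparable to `r` in width:
otherwise it would contain a rectangle of measure greater than `r ^ D`. -/
theorem le_levelRadius (ha : -1 < a) (hb : -1 < b) (hu : IsAdmissible u) {σ τ : ℝ}
    (hσ : 0 < σ) (hτ : 0 < τ) (h : 0 < u (σ, τ)) (hr : levelRadius a b u (u (σ, τ)) ≤ τ) :
    σ ≤ ((a + 1) * (b + 1)) ^ (1 / (a + 1)) * levelRadius a b u (u (σ, τ)) := by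
  have h2 := rpow_mul_rpow_le ha hb hu hσ hτ h
  have hr0 := levelRadius_pos ha hb hu hσ hτ h
  set r := levelRadius a b u (u (σ, τ))
  have ha' : 0 < a + 1 := by linarith
  have hb' : 0 < b + 1 := by linarith
  have h3 : σ ^ (a + 1) * r ^ (b + 1) ≤ (a + 1) * (b + 1) * r ^ (a + 1) * r ^ (b + 1) := by
    calc σ ^ (a + 1) * r ^ (b + 1) ≤ σ ^ (a + 1) * τ ^ (b + 1) := by gcongr
      _ ≤ _ := h2
      _ = _ := by
        rw [mul_assoc ((a + 1) * (b + 1)), ← Real.rpow_add hr0]; ring_nf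
  have h4 := le_of_mul_le_mul_right h3 (by positivity)
  rw [← Real.rpow_le_rpow_iff hσ.le (by positivity) ha', Real.mul_rpow (by positivity) hr0.le,
    ← Real.rpow_mul (by positivity), one_div, inv_mul_cancel₀ ha'.ne', Real.rpow_one]
  exact h4

theorem inv_levelRadius_mul_powMeasure_le (ha : -1 < a) (hb : -1 < b) (hu : IsAdmissible u)
    {σ τ : ℝ} (hσ : 0 < σ) (hτ : 0 < τ) (h : 0 < u (σ, τ))
    (hr : levelRadius a b u (u (σ, τ)) ≤ τ) :
    ENNReal.ofReal (levelRadius a b u (u (σ, τ)))⁻¹ * powMeasure a (Ioo 0 σ) ≤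
      ENNReal.ofReal (σ ^ a) *
        ENNReal.ofReal (((a + 1) * (b + 1)) ^ (1 / (a + 1)) / (a + 1)) := by
  have h2 := le_levelRadius ha hb hu hσ hτ h hr
  have hr0 := levelRadius_pos ha hb hu hσ hτ h
  set r := levelRadius a b u (u (σ, τ))
  have ha' : 0 < a + 1 := by linarith
  rw [powMeasure_Ioo ha hσ.le, ← ENNReal.ofReal_mul (by positivity),
    ← ENNReal.ofReal_mul (by positivity)]
  refine ENNReal.ofReal_le_ofReal ?_
  rw [Real.rpow_add_one hσ.ne', inv_mul_eq_div, div_div, mul_div_assoc', mul_comm (a + 1) r,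
    ← div_div]
  gcongr
  rw [div_le_iff₀ hr0, mul_assoc]
  gcongr

/-- Below the scale `r` no geometry is needed: as `b ≥ 0`, the weight `τ ^ b` controls the
truncated integral `∫ y ^ b dy` over `y < min τ r`. -/
theorem inv_mul_powMeasure_inter_Iio_le (hb : 0 ≤ b) {r τ : ℝ} (hr : 0 < r) (hτ : 0 < τ) :
    ENNReal.ofReal r⁻¹ * powMeasure b (Ioo 0 τ ∩ Iio r) ≤
      ENNReal.ofReal (τ ^ b) * ENNReal.ofReal (1 / (b + 1)) := by
  have hm : 0 < min τ r := lt_min hτ hr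
  rw [Ioo_inter_Iio, powMeasure_Ioo (by linarith) hm.le, ← ENNReal.ofReal_mul (by positivity),
    ← ENNReal.ofReal_mul (by positivity)]
  refine ENNReal.ofReal_le_ofReal ?_
  rw [mul_one_div, mul_div_assoc', Real.rpow_add_one hm.ne']
  gcongr
  rw [inv_mul_le_iff₀ hr, mul_comm r]
  gcongr
  · exact min_le_left _ _
  · exact min_le_right _ _

end

section
variable {a b : ℝ} {u : ℝ × ℝ → ℝ}

theorem measurable_partialSigma (hu : Continuous u) : Measurable (partialSigma u) := by
  have h : Measurable fun p : ℝ × ℝ => deriv (fun s => u (s, p.1)) p.2 :=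
    measurable_deriv_with_param (f := fun t s => u (s, t)) (hu.comp continuous_swap)
  exact h.comp measurable_swap

theorem measurable_partialTau (hu : Continuous u) : Measurable (partialTau u) :=
  measurable_deriv_with_param (f := fun s t => u (s, t)) hu

/-! ### The weighted isoperimetric estimate, integrated over the levels -/

theorem lintegral_slice_sigma_le (ha : -1 < a) (hb : -1 < b) (hu : IsAdmissible u)
    {g : ℝ → ℝ≥0∞} (hg : Measurable g) {τ : ℝ} (hτ : 0 < τ) :
    ∫⁻ t in Ioi 0, g t * ENNReal.ofReal (levelRadius a b u t)⁻¹ *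
        powMeasure a {σ | t < u (σ, τ) ∧ levelRadius a b u t ≤ τ} ≤
      ENNReal.ofReal (((a + 1) * (b + 1)) ^ (1 / (a + 1)) / (a + 1)) *
        ∫⁻ σ, g (u (σ, τ)) * ENNReal.ofReal |partialSigma u (σ, τ)| ∂powMeasure a := by
  have hc := hu.continuous_sigma τ
  have hm : Measurable fun σ => g (u (σ, τ)) * ENNReal.ofReal |partialSigma u (σ, τ)| := by
    refine (hg.comp hc.measurable).mul ?_
    exact (((measurable_partialSigma hu.continuous).comp
      measurable_prodMk_right).abs).ennreal_ofReal
  have key := lintegral_superlevel_le hc (hu.deriv_sigma_neg hτ) (hu.exists_zero_sigma τ)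
    (N := fun t S => g t * ENNReal.ofReal (levelRadius a b u t)⁻¹ *
      powMeasure a (S ∩ {_σ | levelRadius a b u t ≤ τ}))
    (fun t => by simp)
    (h := fun σ => ENNReal.ofReal (σ ^ a) * (ENNReal.ofReal
      (((a + 1) * (b + 1)) ^ (1 / (a + 1)) / (a + 1)) * g (u (σ, τ)))) (fun σ hσ h => by
      by_cases hr : levelRadius a b u (u (σ, τ)) ≤ τ
      · have := inv_levelRadius_mul_powMeasure_le ha hb hu hσ hτ h hr
        simp only [hr, ofPred_true, inter_univ]
        calc _ = g (u (σ, τ)) * (ENNReal.ofReal (levelRadius a b u (u (σ, τ)))⁻¹ *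
              powMeasure a (Ioo 0 σ)) := by ring
          _ ≤ g (u (σ, τ)) * (ENNReal.ofReal (σ ^ a) * ENNReal.ofReal
              (((a + 1) * (b + 1)) ^ (1 / (a + 1)) / (a + 1))) := by gcongr
          _ = _ := by ring
      · simp [hr])
  rw [← lintegral_const_mul _ hm, lintegral_powMeasure _ (hm.const_mul _)]
  refine (lintegral_congr fun t => ?_).trans_le (key.trans_eq (lintegral_congr fun σ => ?_))
  · rw [← powMeasure_setOf_pos]
    refine congrArg (fun S => _ * powMeasure a S) ?_
    ext σ
    simp [and_assoc]
  · simp only [partialSigma]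
    ring

theorem lintegral_slice_tau_le (ha : -1 < a) (hb : 0 ≤ b) (hu : IsAdmissible u)
    {g : ℝ → ℝ≥0∞} (hg : Measurable g) {σ : ℝ} (hσ : 0 < σ) :
    ∫⁻ t in Ioi 0, g t * ENNReal.ofReal (levelRadius a b u t)⁻¹ *
        powMeasure b {τ | t < u (σ, τ) ∧ τ < levelRadius a b u t} ≤
      ENNReal.ofReal (1 / (b + 1)) *
        ∫⁻ τ, g (u (σ, τ)) * ENNReal.ofReal |partialTau u (σ, τ)| ∂powMeasure b := by
  have hc := hu.continuous_tau σ
  have hm : Measurable fun τ => g (u (σ, τ)) * ENNReal.ofReal |partialTau u (σ, τ)| := by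
    refine (hg.comp hc.measurable).mul ?_
    exact (((measurable_partialTau hu.continuous).comp
      measurable_prodMk_left).abs).ennreal_ofReal
  have key := lintegral_superlevel_le hc (hu.deriv_tau_neg hσ) (hu.exists_zero_tau σ)
    (N := fun t S => g t * ENNReal.ofReal (levelRadius a b u t)⁻¹ *
      powMeasure b (S ∩ Iio (levelRadius a b u t)))
    (fun t => by simp)
    (h := fun τ => ENNReal.ofReal (τ ^ b) * (ENNReal.ofReal (1 / (b + 1)) * g (u (σ, τ))))
    (fun τ hτ h => by
      have := inv_mul_powMeasure_inter_Iio_le hb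
        (levelRadius_pos ha (by linarith : -1 < b) hu hσ hτ h) hτ
      calc _ = g (u (σ, τ)) * (ENNReal.ofReal (levelRadius a b u (u (σ, τ)))⁻¹ *
            powMeasure b (Ioo 0 τ ∩ Iio (levelRadius a b u (u (σ, τ))))) := by ring
        _ ≤ g (u (σ, τ)) * (ENNReal.ofReal (τ ^ b) * ENNReal.ofReal (1 / (b + 1))) := by gcongr
        _ = _ := by ring)
  rw [← lintegral_const_mul _ hm, lintegral_powMeasure _ (hm.const_mul _)]
  refine (lintegral_congr fun t => ?_).trans_le (key.trans_eq (lintegral_congr fun τ => ?_))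
  · rw [← powMeasure_setOf_pos]
    refine congrArg (fun S => _ * powMeasure b S) ?_
    ext τ
    simp [and_assoc]
  · simp only [partialTau]
    ring

theorem lintegral_above_radius_le (ha : -1 < a) (hb : -1 < b) (hu : IsAdmissible u)
    {g : ℝ → ℝ≥0∞} (hg : Measurable g) :
    ∫⁻ t in Ioi 0, g t * ENNReal.ofReal (levelRadius a b u t)⁻¹ *
        monomialMeasure a b {p | t < u p ∧ levelRadius a b u t ≤ p.2} ≤
      ENNReal.ofReal (((a + 1) * (b + 1)) ^ (1 / (a + 1)) / (a + 1)) *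
        ∫⁻ p, g (u p) * ENNReal.ofReal |partialSigma u p| ∂monomialMeasure a b := by
  have hM : Measurable fun t => g t * ENNReal.ofReal (levelRadius a b u t)⁻¹ :=
    hg.mul (measurable_levelRadius a b u).inv.ennreal_ofReal
  have hS : MeasurableSet {q : ℝ × ℝ × ℝ | q.1 < u q.2 ∧ levelRadius a b u q.1 ≤ q.2.2} :=
    (measurableSet_lt measurable_fst (hu.continuous.measurable.comp measurable_snd)).inter
      (measurableSet_le ((measurable_levelRadius a b u).comp measurable_fst)
        (measurable_snd.comp measurable_snd))
  have hF : Measurable fun p => g (u p) * ENNReal.ofReal |partialSigma u p| :=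
    (hg.comp hu.continuous.measurable).mul
      (measurable_partialSigma hu.continuous).abs.ennreal_ofReal
  refine (lintegral_mul_prod_slice_symm (μ := powMeasure a) (ν := powMeasure b) hM hS).trans_le ?_
  rw [monomialMeasure, lintegral_prod_symm' _ hF, ← lintegral_const_mul _ hF.lintegral_prod_left']
  refine lintegral_mono_ae ?_
  filter_upwards [ae_powMeasure_pos b] with τ hτ
  exact lintegral_slice_sigma_le ha hb hu hg hτ

theorem lintegral_below_radius_le (ha : -1 < a) (hb : 0 ≤ b) (hu : IsAdmissible u)
    {g : ℝ → ℝ≥0∞} (hg : Measurable g) :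
    ∫⁻ t in Ioi 0, g t * ENNReal.ofReal (levelRadius a b u t)⁻¹ *
        monomialMeasure a b {p | t < u p ∧ p.2 < levelRadius a b u t} ≤
      ENNReal.ofReal (1 / (b + 1)) *
        ∫⁻ p, g (u p) * ENNReal.ofReal |partialTau u p| ∂monomialMeasure a b := by
  have hM : Measurable fun t => g t * ENNReal.ofReal (levelRadius a b u t)⁻¹ :=
    hg.mul (measurable_levelRadius a b u).inv.ennreal_ofReal
  have hS : MeasurableSet {q : ℝ × ℝ × ℝ | q.1 < u q.2 ∧ q.2.2 < levelRadius a b u q.1} :=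
    (measurableSet_lt measurable_fst (hu.continuous.measurable.comp measurable_snd)).inter
      (measurableSet_lt (measurable_snd.comp measurable_snd)
        ((measurable_levelRadius a b u).comp measurable_fst))
  have hF : Measurable fun p => g (u p) * ENNReal.ofReal |partialTau u p| :=
    (hg.comp hu.continuous.measurable).mul
      (measurable_partialTau hu.continuous).abs.ennreal_ofReal
  refine (lintegral_mul_prod_slice (μ := powMeasure a) (ν := powMeasure b) hM hS).trans_le ?_
  rw [monomialMeasure, lintegral_prod _ hF.aemeasurable,
    ← lintegral_const_mul _ hF.lintegral_prod_right']
  refine lintegral_mono_ae ?_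
  filter_upwards [ae_powMeasure_pos a] with σ hσ
  exact lintegral_slice_tau_le ha hb hu hg hσ

theorem levelMeasure_rpow (hD : 1 < 2 + a + b) {t : ℝ} (ht : levelMeasure a b u t ≠ ∞) :
    ENNReal.ofReal (levelRadius a b u t)⁻¹ * levelMeasure a b u t =
      levelMeasure a b u t ^ (1 - 1 / (2 + a + b)) := by
  have h1 : 1 - 1 / (2 + a + b) ≠ 0 := by
    have : 1 / (2 + a + b) < 1 := by rw [div_lt_one (by linarith)]; exact hD
    linarith
  obtain ⟨v, hv⟩ : ∃ v : ℝ≥0, levelMeasure a b u t = v := ⟨_, (ENNReal.coe_toNNReal ht).symm⟩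
  rw [levelRadius, hv]
  rcases eq_or_ne v 0 with rfl | hv0
  · have : 0 < 1 - 1 / (2 + a + b) := by
      rw [sub_pos, div_lt_one (by linarith)]; exact hD
    rw [ENNReal.coe_zero, mul_zero, ENNReal.zero_rpow_of_pos this]
  · have hv1 : (0 : ℝ) < v := by positivity
    rw [ENNReal.coe_toReal, ← ENNReal.ofReal_coe_nnreal, ← ENNReal.ofReal_mul (by positivity),
      ENNReal.ofReal_rpow_of_pos hv1, ← Real.rpow_neg hv1.le, ← Real.rpow_add_one hv1.ne']
    ring_nf

/-- Each superlevel set is split at height `τ = r`; the upper part is measured by horizontal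
lines, the lower part by vertical ones. -/
theorem lintegral_levelMeasure_rpow_le (ha : -1 < a) (hb : 0 < b) (hu : IsAdmissible u)
    {g : ℝ → ℝ≥0∞} (hg : Measurable g) :
    ∫⁻ t in Ioi 0, g t * levelMeasure a b u t ^ (1 - 1 / (2 + a + b)) ≤
      ENNReal.ofReal (((a + 1) * (b + 1)) ^ (1 / (a + 1)) / (a + 1) + 1 / (b + 1)) *
        ∫⁻ p, g (u p) * ENNReal.ofReal (gradNorm u p) ∂monomialMeasure a b := by
  have hb' : -1 < b := by linarith
  have ha1 : 0 < a + 1 := by linarith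
  have hr := measurable_levelRadius a b u
  have hM : Measurable fun t => g t * ENNReal.ofReal (levelRadius a b u t)⁻¹ :=
    hg.mul hr.inv.ennreal_ofReal
  have hS : MeasurableSet {q : ℝ × ℝ × ℝ | q.1 < u q.2 ∧ q.2.2 < levelRadius a b u q.1} :=
    (measurableSet_lt measurable_fst (hu.continuous.measurable.comp measurable_snd)).inter
      (measurableSet_lt (measurable_snd.comp measurable_snd) (hr.comp measurable_fst))
  have hsplit : ∀ t ∈ Ioi (0 : ℝ), g t * levelMeasure a b u t ^ (1 - 1 / (2 + a + b)) =
      g t * ENNReal.ofReal (levelRadius a b u t)⁻¹ *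
          monomialMeasure a b {p | t < u p ∧ levelRadius a b u t ≤ p.2} +
        g t * ENNReal.ofReal (levelRadius a b u t)⁻¹ *
          monomialMeasure a b {p | t < u p ∧ p.2 < levelRadius a b u t} := by
    intro t ht
    rw [← levelMeasure_rpow (by linarith) (levelMeasure_ne_top ha hb' hu ht), ← mul_add,
      ← mul_assoc, add_comm]
    have := measure_inter_add_sdiff (μ := monomialMeasure a b) {p | t < u p}
      (measurableSet_lt measurable_snd (measurable_const (a := levelRadius a b u t)))
    rw [levelMeasure, ← this]
    congr 3
    ext p
    simp
  rw [setLIntegral_congr_fun measurableSet_Ioi hsplit, lintegral_add_right]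
  · have e1 : ∀ p, |partialSigma u p| ≤ gradNorm u p := fun p =>
      Real.abs_le_sqrt (by nlinarith [sq_nonneg (partialTau u p)])
    have e2 : ∀ p, |partialTau u p| ≤ gradNorm u p := fun p =>
      Real.abs_le_sqrt (by nlinarith [sq_nonneg (partialSigma u p)])
    rw [ENNReal.ofReal_add (by positivity) (by positivity), add_mul]
    refine add_le_add ((lintegral_above_radius_le ha hb' hu hg).trans ?_)
      ((lintegral_below_radius_le ha hb.le hu hg).trans ?_)
    · gcongr with p
      exact e1 p
    · gcongr with p
      exact e2 p
  · refine hM.mul ?_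
    exact measurable_measure_prodMk_left hS

end

/-! ### From superlevel sets to Lebesgue norms -/

/-- The elementary embedding behind `‖f‖_p ≤ ∫ μ {f > t} ^ (1 / p) dt`, up to a constant and
applied to `f ^ γ`: as `μ {f > t}` decreases in `t`, the product `t ^ γ μ {f > t} ^ (1 / p)` is
bounded by the integral on the right, and this bounds `p - 1` of the `p` factors in the layer cake
formula. -/
theorem lintegral_rpow_le_lintegral_measure_rpow {α : Type*} [MeasurableSpace α] (μ : Measure α)
    {f : α → ℝ} (hf0 : ∀ x, 0 ≤ f x) (hf : Measurable f) {γ p : ℝ} (hγ : 0 < γ) (hp : 1 < p) :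
    ∫⁻ x, ENNReal.ofReal (f x ^ (γ * p)) ∂μ ≤
      ENNReal.ofReal p *
        (ENNReal.ofReal γ * ∫⁻ t, μ {x | t < f x} ^ (1 / p) ∂powMeasure (γ - 1)) ^ p := by
  have hp0 : 0 < p := by linarith
  set V : ℝ → ℝ≥0∞ := fun t => μ {x | t < f x} with hV
  have hanti : Antitone V := fun _ _ h => measure_mono fun _ hx => lt_of_le_of_lt h hx
  have hVm : Measurable fun t => V t ^ (1 / p) := hanti.measurable.pow_const _
  set J := ∫⁻ t, V t ^ (1 / p) ∂powMeasure (γ - 1) with hJ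
  have hkey : ∀ t, 0 < t → ENNReal.ofReal (t ^ γ) * V t ^ (1 / p) ≤ ENNReal.ofReal γ * J := by
    intro t ht
    have h1 : V t ^ (1 / p) * powMeasure (γ - 1) (Ioo 0 t) ≤ J := by
      rw [← setLIntegral_const]
      refine (setLIntegral_mono hVm fun s hs => ?_).trans (setLIntegral_le_lintegral _ _)
      exact ENNReal.rpow_le_rpow (hanti hs.2.le) (by positivity)
    rw [powMeasure_Ioo (by linarith) ht.le, sub_add_cancel] at h1
    calc ENNReal.ofReal (t ^ γ) * V t ^ (1 / p)
        = ENNReal.ofReal γ * (V t ^ (1 / p) * ENNReal.ofReal (t ^ γ / γ)) := by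
          rw [mul_left_comm, ← ENNReal.ofReal_mul hγ.le, mul_div_cancel₀ _ hγ.ne', mul_comm]
      _ ≤ _ := by gcongr
  have hpt : ∀ t ∈ Ioi (0 : ℝ), V t * ENNReal.ofReal (t ^ (γ * p - 1)) ≤
      (ENNReal.ofReal γ * J) ^ (p - 1) * (ENNReal.ofReal (t ^ (γ - 1)) * V t ^ (1 / p)) := by
    intro t ht
    have ht : 0 < t := ht
    calc V t * ENNReal.ofReal (t ^ (γ * p - 1))
        = (ENNReal.ofReal (t ^ γ) * V t ^ (1 / p)) ^ (p - 1) *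
            (ENNReal.ofReal (t ^ (γ - 1)) * V t ^ (1 / p)) := by
          rw [ENNReal.mul_rpow_of_nonneg _ _ (by linarith), mul_mul_mul_comm,
            ENNReal.ofReal_rpow_of_pos (by positivity), ← ENNReal.ofReal_mul (by positivity),
            ← Real.rpow_mul ht.le, ← Real.rpow_add ht, ← ENNReal.rpow_mul,
            ← ENNReal.rpow_add_of_nonneg _ _
              (mul_nonneg (by positivity) (by linarith)) (by positivity)]
          have e1 : 1 / p * (p - 1) + 1 / p = 1 := by field_simp; ring
          have e2 : γ * (p - 1) + (γ - 1) = γ * p - 1 := by ring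
          rw [e1, e2, ENNReal.rpow_one, mul_comm]
      _ ≤ _ := mul_le_mul' (ENNReal.rpow_le_rpow (hkey t ht) (by linarith)) le_rfl
  rw [lintegral_rpow_eq_lintegral_meas_lt_mul μ (Filter.Eventually.of_forall hf0) hf.aemeasurable
    (mul_pos hγ hp0)]
  calc ENNReal.ofReal (γ * p) * ∫⁻ t in Ioi 0, V t * ENNReal.ofReal (t ^ (γ * p - 1))
      ≤ ENNReal.ofReal (γ * p) * ∫⁻ t in Ioi 0, (ENNReal.ofReal γ * J) ^ (p - 1) *
          (ENNReal.ofReal (t ^ (γ - 1)) * V t ^ (1 / p)) := by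
        gcongr ENNReal.ofReal (γ * p) * ?_
        exact setLIntegral_mono' measurableSet_Ioi hpt
    _ = ENNReal.ofReal p *
          ((ENNReal.ofReal γ * J) ^ (p - 1) * (ENNReal.ofReal γ * J) ^ (1 : ℝ)) := by
        have hm : Measurable fun t => ENNReal.ofReal (t ^ (γ - 1)) * V t ^ (1 / p) :=
          (measurable_ofReal_rpow _).mul hVm
        rw [lintegral_const_mul _ hm, ← lintegral_powMeasure _ hVm,
          ← hJ, ENNReal.ofReal_mul hγ.le, ENNReal.rpow_one]
        ring
    _ = _ := by
        rw [← ENNReal.rpow_add_of_nonneg _ _ (by linarith) zero_le_one, sub_add_cancel]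

section
variable {a b : ℝ} {u : ℝ × ℝ → ℝ}

theorem measurable_gradNorm (hu : Continuous u) : Measurable (gradNorm u) :=
  (((measurable_partialSigma hu).pow_const 2).add
    ((measurable_partialTau hu).pow_const 2)).sqrt

theorem gradNorm_nonneg (u : ℝ × ℝ → ℝ) (p : ℝ × ℝ) : 0 ≤ gradNorm u p := Real.sqrt_nonneg _

theorem gradNorm_eq_zero {p : ℝ × ℝ} (hp : p ∉ tsupport u) : gradNorm u p = 0 := by
  have h := notMem_tsupport_iff_eventuallyEq.1 hp
  have h1 : partialSigma u p = 0 := by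
    have ht : Filter.Tendsto (fun s => (s, p.2)) (nhds p.1) (nhds p) :=
      (show Continuous fun s : ℝ => (s, p.2) by fun_prop).tendsto p.1
    exact (h.comp_tendsto ht).deriv_eq.trans (deriv_const _ _)
  have h2 : partialTau u p = 0 := by
    have ht : Filter.Tendsto (fun s => (p.1, s)) (nhds p.2) (nhds p) :=
      (show Continuous fun s : ℝ => (p.1, s) by fun_prop).tendsto p.2
    exact (h.comp_tendsto ht).deriv_eq.trans (deriv_const _ _)
  simp [gradNorm, h1, h2]

theorem IsAdmissible.exists_gradNorm_le (hu : IsAdmissible u) : ∃ M, ∀ p, gradNorm u p ≤ M := by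
  obtain ⟨K, hK⟩ := hu.lipschitz
  refine ⟨√((K : ℝ) ^ 2 + (K : ℝ) ^ 2), fun p => Real.sqrt_le_sqrt (add_le_add ?_ ?_)⟩
  · rw [← sq_abs]
    have : LipschitzWith K fun s => u (s, p.2) := by
      simpa [Function.comp_def] using hK.comp (LipschitzWith.prodMk_right (α := ℝ) p.2)
    gcongr
    exact norm_deriv_le_of_lipschitz this
  · rw [← sq_abs]
    have : LipschitzWith K fun s => u (p.1, s) := by
      simpa [Function.comp_def] using hK.comp (LipschitzWith.prodMk_left (β := ℝ) p.1)
    gcongr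
    exact norm_deriv_le_of_lipschitz this

theorem IsAdmissible.exists_le (hu : IsAdmissible u) : ∃ M, ∀ p, u p ≤ M := by
  obtain ⟨M, hM⟩ := hu.compact_support.exists_bound_of_continuous hu.continuous
  exact ⟨M, fun p => (le_abs_self _).trans (hM p)⟩

/-! ### Integrals against the monomial weight -/

theorem integrable_monomialMeasure_iff {F : ℝ × ℝ → ℝ} :
    Integrable F (monomialMeasure a b) ↔
      IntegrableOn (fun p => monomialWeight a b p * F p) quadrant := by
  rw [monomialMeasure_eq_withDensity, integrable_withDensity_iff_integrable_smul'
    (measurable_monomialWeight a b).ennreal_ofReal (by simp)]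
  refine integrable_congr ?_
  filter_upwards [ae_restrict_mem (measurableSet_Ioi.prod measurableSet_Ioi)] with p hp
  rw [ENNReal.toReal_ofReal, smul_eq_mul]
  exact mul_nonneg (Real.rpow_nonneg (le_of_lt hp.1) _) (Real.rpow_nonneg (le_of_lt hp.2) _)

theorem integral_monomialMeasure (F : ℝ × ℝ → ℝ) :
    ∫ p, F p ∂monomialMeasure a b = ∫ p in quadrant, monomialWeight a b p * F p := by
  rw [monomialMeasure_eq_withDensity, integral_withDensity_eq_integral_toReal_smul
    (measurable_monomialWeight a b).ennreal_ofReal (by simp)]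
  refine integral_congr_ae ?_
  filter_upwards [ae_restrict_mem (measurableSet_Ioi.prod measurableSet_Ioi)] with p hp
  rw [ENNReal.toReal_ofReal, smul_eq_mul]
  exact mul_nonneg (Real.rpow_nonneg (le_of_lt hp.1) _) (Real.rpow_nonneg (le_of_lt hp.2) _)

theorem integrable_rpow_of_isCompact (ha : -1 < a) (hb : -1 < b) {k : Set (ℝ × ℝ)}
    (hk : IsCompact k) {F : ℝ × ℝ → ℝ} (hF : Measurable F) (h0 : ∀ p, 0 ≤ F p) {M : ℝ}
    (hM : ∀ p, F p ≤ M) (hFk : ∀ p ∉ k, F p = 0) {r : ℝ} (hr : 0 < r) :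
    Integrable (fun p => F p ^ r) (monomialMeasure a b) := by
  have hsupp : Function.support (fun p => F p ^ r) ⊆ k := by
    intro p hp
    by_contra hpk
    exact hp (by simp [hFk p hpk, hr.ne'])
  rw [← integrableOn_iff_integrable_of_support_subset hsupp]
  refine Measure.integrableOn_of_bounded (M := M ^ r)
    (monomialMeasure_lt_top_of_isCompact ha hb hk).ne
    (hF.pow_const r).aestronglyMeasurable (Filter.Eventually.of_forall fun p => ?_)
  rw [Real.norm_of_nonneg (Real.rpow_nonneg (h0 p) _)]
  exact Real.rpow_le_rpow (h0 p) (hM p) hr.le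

theorem integrable_rpow (ha : -1 < a) (hb : -1 < b) (hu : IsAdmissible u) {r : ℝ} (hr : 0 < r) :
    Integrable (fun p => u p ^ r) (monomialMeasure a b) :=
  let ⟨_, hM⟩ := hu.exists_le
  integrable_rpow_of_isCompact ha hb hu.compact_support.isCompact hu.continuous.measurable
    hu.nonneg hM (fun _ hp => image_eq_zero_of_notMem_tsupport hp) hr

theorem integrable_gradNorm_rpow (ha : -1 < a) (hb : -1 < b) (hu : IsAdmissible u) {r : ℝ}
    (hr : 0 < r) : Integrable (fun p => gradNorm u p ^ r) (monomialMeasure a b) :=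
  let ⟨_, hM⟩ := hu.exists_gradNorm_le
  integrable_rpow_of_isCompact ha hb hu.compact_support.isCompact
    (measurable_gradNorm hu.continuous) (gradNorm_nonneg u) hM (fun _ hp => gradNorm_eq_zero hp) hr

/-! ### The Sobolev inequality -/

theorem lintegral_rpow_mul_gradNorm_le (hu : IsAdmissible u) {γ q r : ℝ} (hq : 1 ≤ q)
    (hγ : (γ - 1) * q = r * (q - 1)) :
    ∫⁻ p, ENNReal.ofReal (u p ^ (γ - 1)) * ENNReal.ofReal (gradNorm u p) ∂monomialMeasure a b ≤
      (∫⁻ p, ENNReal.ofReal (u p ^ r) ∂monomialMeasure a b) ^ (1 - 1 / q) *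
        (∫⁻ p, ENNReal.ofReal (gradNorm u p ^ q) ∂monomialMeasure a b) ^ (1 / q) := by
  rcases hq.eq_or_lt with rfl | hq1
  · have : γ = 1 := by linarith
    simp [this]
  · have hq0 : 0 < q := by linarith
    have hconj : (q / (q - 1)).HolderConjugate q := (Real.HolderConjugate.conjExponent hq1).symm
    have h := ENNReal.lintegral_mul_le_Lp_mul_Lq (monomialMeasure a b) hconj
      (f := fun p => ENNReal.ofReal (u p ^ (γ - 1))) (g := fun p => ENNReal.ofReal (gradNorm u p))
      (hu.continuous.measurable.pow_const _).ennreal_ofReal.aemeasurable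
      (measurable_gradNorm hu.continuous).ennreal_ofReal.aemeasurable
    have e1 : 1 / (q / (q - 1)) = 1 - 1 / q := by
      field_simp
    have e2 : (γ - 1) * (q / (q - 1)) = r := by
      rw [← mul_div_assoc, hγ, mul_div_cancel_right₀ _ (by linarith)]
    have e3 : ∀ p, ENNReal.ofReal (u p ^ (γ - 1)) ^ (q / (q - 1)) = ENNReal.ofReal (u p ^ r) := by
      intro p
      rw [ENNReal.ofReal_rpow_of_nonneg (Real.rpow_nonneg (hu.nonneg p) _)
        (div_nonneg hq0.le (by linarith)), ← Real.rpow_mul (hu.nonneg p), e2]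
    have e4 : ∀ p, ENNReal.ofReal (gradNorm u p) ^ q = ENNReal.ofReal (gradNorm u p ^ q) :=
      fun p => ENNReal.ofReal_rpow_of_nonneg (gradNorm_nonneg u p) hq0.le
    simp only [Pi.mul_apply, e1, e3, e4] at h
    exact h

theorem exists_lintegral_sobolev (ha : -1 < a) (hb : 0 < b) {q : ℝ} (hq : 1 ≤ q)
    (hqD : q < 2 + a + b) :
    ∃ C : ℝ, 0 < C ∧ ∀ u : ℝ × ℝ → ℝ, IsAdmissible u →
      (∫⁻ p, ENNReal.ofReal (u p ^ ((2 + a + b) * q / (2 + a + b - q))) ∂monomialMeasure a b) ^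
          (1 / ((2 + a + b) * q / (2 + a + b - q))) ≤
        ENNReal.ofReal C *
          (∫⁻ p, ENNReal.ofReal (gradNorm u p ^ q) ∂monomialMeasure a b) ^ (1 / q) := by
  obtain ⟨D, hD⟩ : ∃ D, D = 2 + a + b := ⟨_, rfl⟩
  have ha1 : 0 < a + 1 := by linarith
  have hD1 : 1 < D := by linarith
  have hDq : 0 < D - q := by linarith
  have hq0 : 0 < q := by linarith
  set K : ℝ := ((a + 1) * (b + 1)) ^ (1 / (a + 1)) / (a + 1) + 1 / (b + 1) with hK
  have hK0 : 0 < K := by positivity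
  rw [← hD]
  set r : ℝ := D * q / (D - q) with hr
  -- `p` is the Sobolev exponent for `q = 1`; the case of general `q` comes from `u ^ γ`.
  set p : ℝ := D / (D - 1) with hp
  set γ : ℝ := q * (D - 1) / (D - q) with hγ
  have hD10 : 0 < D - 1 := by linarith
  have hr0 : 0 < r := by positivity
  have hp1 : 1 < p := by rw [hp, lt_div_iff₀ hD10]; linarith
  have hp0 : 0 < p := by linarith
  have hγ0 : 0 < γ := by positivity
  have hγp : γ * p = r := by rw [hγ, hp, hr]; field_simp
  have hinvp : 1 / p = 1 - 1 / (2 + a + b) := by rw [hp, ← hD]; field_simp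
  have hγq : (γ - 1) * q = r * (q - 1) := by rw [hγ, hr]; field_simp; ring
  have hexp : 1 / r + (1 - 1 / q) = 1 / p := by rw [hr, hp]; field_simp; ring
  refine ⟨p ^ (1 / p) * (γ * K), by positivity, fun u hu => ?_⟩
  set X := ∫⁻ x, ENNReal.ofReal (u x ^ r) ∂monomialMeasure a b with hX
  set Y := ∫⁻ x, ENNReal.ofReal (gradNorm u x ^ q) ∂monomialMeasure a b
  have hXtop : X ≠ ∞ := by
    have := (integrable_rpow ha (by linarith : -1 < b) hu hr0).lintegral_lt_top
    exact this.ne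
  rcases eq_or_ne X 0 with h0 | h0
  · rw [h0, ENNReal.zero_rpow_of_pos (by positivity)]
    exact zero_le
  have h1 := lintegral_rpow_le_lintegral_measure_rpow (monomialMeasure a b) hu.nonneg
    hu.continuous.measurable hγ0 hp1
  rw [hγp, ← hX] at h1
  have h2 : ∫⁻ t, monomialMeasure a b {x | t < u x} ^ (1 / p) ∂powMeasure (γ - 1) ≤
      ENNReal.ofReal K * (X ^ (1 - 1 / q) * Y ^ (1 / q)) := by
    change ∫⁻ t, levelMeasure a b u t ^ (1 / p) ∂powMeasure (γ - 1) ≤ _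
    rw [lintegral_powMeasure _ ((levelMeasure_antitone a b u).measurable.pow_const _), hinvp]
    refine (lintegral_levelMeasure_rpow_le ha hb hu (measurable_ofReal_rpow (γ - 1))).trans ?_
    exact mul_le_mul' le_rfl (lintegral_rpow_mul_gradNorm_le hu hq hγq)
  have h3 : X ^ (1 / p) ≤ ENNReal.ofReal (p ^ (1 / p)) * (ENNReal.ofReal γ *
      (ENNReal.ofReal K * (X ^ (1 - 1 / q) * Y ^ (1 / q)))) := by
    calc X ^ (1 / p) ≤ (ENNReal.ofReal p * (ENNReal.ofReal γ *
          (ENNReal.ofReal K * (X ^ (1 - 1 / q) * Y ^ (1 / q)))) ^ p) ^ (1 / p) := by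
          refine ENNReal.rpow_le_rpow (h1.trans ?_) (by positivity)
          gcongr
      _ = _ := by
          rw [ENNReal.mul_rpow_of_nonneg _ _ (by positivity), ENNReal.ofReal_rpow_of_pos hp0,
            ← ENNReal.rpow_mul, mul_one_div_cancel hp0.ne', ENNReal.rpow_one]
  rw [← hexp, ENNReal.rpow_add _ _ h0 hXtop] at h3
  have hq1 : 0 ≤ 1 - 1 / q := by
    rw [sub_nonneg, div_le_one hq0]; exact hq
  refine (ENNReal.mul_le_mul_iff_left (ENNReal.rpow_pos (pos_iff_ne_zero.2 h0) hXtop).ne'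
    (ENNReal.rpow_ne_top_of_nonneg hq1 hXtop)).1 (h3.trans_eq ?_)
  rw [ENNReal.ofReal_mul (by positivity), ENNReal.ofReal_mul hγ0.le, hexp]
  ring

theorem IsAdmissible.swap (hu : IsAdmissible u) : IsAdmissible (u ∘ Prod.swap) where
  nonneg p := hu.nonneg _
  lipschitz := by
    obtain ⟨K, hK⟩ := hu.lipschitz
    refine ⟨K, LipschitzWith.of_dist_le_mul fun p q => ?_⟩
    refine (hK.dist_le_mul _ _).trans_eq ?_
    simp [Prod.dist_eq, max_comm]
  compact_support := hu.compact_support.comp_homeomorph (Homeomorph.prodComm ℝ ℝ)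
  contDiffOn := hu.contDiffOn.comp (contDiff_snd.prodMk contDiff_fst).contDiffOn fun _ hp => hp
  partialSigma_nonpos p hp := hu.partialTau_nonpos p.swap ⟨hp.2, hp.1⟩
  partialTau_nonpos p hp := hu.partialSigma_nonpos p.swap ⟨hp.2, hp.1⟩
  partialSigma_neg p hp := hu.partialTau_neg p.swap ⟨hp.2, hp.1⟩
  partialTau_neg p hp := hu.partialSigma_neg p.swap ⟨hp.2, hp.1⟩

theorem gradNorm_comp_swap (u : ℝ × ℝ → ℝ) (p : ℝ × ℝ) :
    gradNorm (u ∘ Prod.swap) p = gradNorm u p.swap :=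
  congrArg Real.sqrt (add_comm _ _)

theorem lintegral_monomialMeasure_swap (a b : ℝ) {F : ℝ × ℝ → ℝ≥0∞} (hF : Measurable F) :
    ∫⁻ p, F p.swap ∂monomialMeasure b a = ∫⁻ p, F p ∂monomialMeasure a b := by
  rw [← lintegral_map hF measurable_swap, monomialMeasure, Measure.prod_swap, monomialMeasure]

end

theorem proposition1p7 (a b D : ℝ) (ha : -1 < a) (hb : -1 < b) (hab : 0 < a ∨ 0 < b)
    (hD : D = 2 + a + b) (q : ℝ) (hq1 : 1 ≤ q) (hqD : q < D) (qstar : ℝ)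
    (hqstar : qstar = D * q / (D - q)) :
    ∃ C : ℝ, 0 < C ∧ ∀ u : ℝ × ℝ → ℝ, IsAdmissible u →
      IntegrableOn (fun p => monomialWeight a b p * |u p| ^ qstar) quadrant volume ∧
      IntegrableOn (fun p => monomialWeight a b p * gradNorm u p ^ q) quadrant volume ∧
      (∫ p in quadrant, monomialWeight a b p * |u p| ^ qstar) ^ (1 / qstar) ≤
        C * (∫ p in quadrant, monomialWeight a b p * gradNorm u p ^ q) ^ (1 / q) := by
  have hq0 : 0 < q := by linarith
  have hD0 : 0 < D - q := by linarith
  have hr0 : 0 < qstar := by rw [hqstar]; exact div_pos (mul_pos (by linarith) hq0) hD0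
  have main : ∃ C : ℝ, 0 < C ∧ ∀ u : ℝ × ℝ → ℝ, IsAdmissible u →
      (∫⁻ p, ENNReal.ofReal (u p ^ qstar) ∂monomialMeasure a b) ^ (1 / qstar) ≤
        ENNReal.ofReal C *
          (∫⁻ p, ENNReal.ofReal (gradNorm u p ^ q) ∂monomialMeasure a b) ^ (1 / q) := by
    rcases hab with ha0 | hb0
    · obtain ⟨C, hC, h⟩ := exists_lintegral_sobolev hb ha0 hq1
        (show q < 2 + b + a by linarith)
      rw [show 2 + b + a = D by linarith, ← hqstar] at h
      refine ⟨C, hC, fun u hu => ?_⟩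
      have hs := h _ hu.swap
      simp only [gradNorm_comp_swap, Function.comp_apply] at hs
      rwa [lintegral_monomialMeasure_swap a b (F := fun p => ENNReal.ofReal (u p ^ qstar))
          (hu.continuous.measurable.pow_const _).ennreal_ofReal,
        lintegral_monomialMeasure_swap a b (F := fun p => ENNReal.ofReal (gradNorm u p ^ q))
          ((measurable_gradNorm hu.continuous).pow_const _).ennreal_ofReal] at hs
    · rw [hqstar, hD]
      exact exists_lintegral_sobolev ha hb0 hq1 (hD ▸ hqD)
  obtain ⟨C, hC, h⟩ := main
  refine ⟨C, hC, fun u hu => ?_⟩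
  have hi1 := integrable_rpow ha hb hu hr0
  have hi2 := integrable_gradNorm_rpow ha hb hu hq0
  simp only [abs_of_nonneg (hu.nonneg _)]
  refine ⟨integrable_monomialMeasure_iff.1 hi1, integrable_monomialMeasure_iff.1 hi2, ?_⟩
  rw [← integral_monomialMeasure, ← integral_monomialMeasure,
    integral_eq_lintegral_of_nonneg_ae
      (Filter.Eventually.of_forall fun p => Real.rpow_nonneg (hu.nonneg p) _) hi1.1,
    integral_eq_lintegral_of_nonneg_ae
      (Filter.Eventually.of_forall fun p => Real.rpow_nonneg (gradNorm_nonneg u p) _) hi2.1,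
    ENNReal.toReal_rpow, ENNReal.toReal_rpow, ← ENNReal.toReal_ofReal hC.le, ← ENNReal.toReal_mul]
  refine ENNReal.toReal_mono (ENNReal.mul_ne_top ENNReal.ofReal_ne_top
    (ENNReal.rpow_ne_top_of_nonneg (by positivity) ?_)) (h u hu)
  exact hi2.lintegral_lt_top.ne
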